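/- Let $G=(V,E)$ be a finite simple graph with graph distance $d$, and let $1\le r\le t$ be integers. For a set $S\subseteq V$ of broadcasting vertices, the reception strength at $u\in V$ is \[ r_S(u)=\sum_{v\in S,\ d(u,v)<t}\bigl(t-d(u,v)\bigr), \] and $S$ is a $(t,r)$ broadcast dominating set if $r_S(u)\ge r$ for every $u\in V$. The $(t,r)$ broadcast domination number $\gamma_{t,r}(G)$ is the minimum cardinality of a $(t,r)$ broadcast dominating set of $G$. Let $G_{m,n}$ be the $m\times n$ grid graph, that is, the Cartesian product of the paths on $m$ and on $n$ vertices. Theorem. For every integer $n\ge 5$, \[ \gamma_{2,2}(G_{5,n}) = 2n+\left\lceil \frac{n+2}{7}\right\rceil . \] -/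

import Mathlib

namespace BroadcastDomination

/-- The broadcast neighborhood `N_t(v)`: all vertices `u` at distance less than `t` from `v`.
The extended distance is used, so vertices in other components are excluded. -/
def broadcastNeighborhood {V : Type*} (G : SimpleGraph V) (t : ℕ) (v : V) : Set V :=
  {u | G.edist u v < (t : ℕ∞)}

open Classical in
/-- The reception strength at `u` of the broadcasting set `S`: the sum of the transmission
strengths `t - d(u, v)` over those `v ∈ S` with `u ∈ N_t(v)`. In each term of the sum
`d(u, v) < t`, so the subtraction does not truncate. -/
noncomputable def receptionStrength {V : Type*} (G : SimpleGraph V) (t : ℕ) (S : Finset V)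
    (u : V) : ℕ :=
  ∑ v ∈ S with u ∈ broadcastNeighborhood G t v, (t - G.dist u v)

/-- `S` is a `(t, r)` broadcast dominating set: every vertex has reception strength at
least `r`. -/
def IsBroadcastDominatingSet {V : Type*} (G : SimpleGraph V) (t r : ℕ) (S : Finset V) : Prop :=
  ∀ u : V, r ≤ receptionStrength G t S u

/-- The `(t, r)` broadcast domination number `γ_{t,r}(G)` of a finite graph: the minimum size of
a `(t, r)` broadcast dominating set. -/
noncomputable def broadcastDominationNumber {V : Type*} [Fintype V] (G : SimpleGraph V)
    (t r : ℕ) : ℕ :=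
  sInf {k : ℕ | ∃ S : Finset V, IsBroadcastDominatingSet G t r S ∧ S.card = k}

/-- For `1 ≤ r ≤ t` the set of all vertices is a `(t, r)` broadcast dominating set, so the
minimum in the definition of `γ_{t,r}(G)` is attained. -/
theorem isBroadcastDominatingSet_univ {V : Type*} [Fintype V] (G : SimpleGraph V) {t r : ℕ}
    (hr : 1 ≤ r) (hrt : r ≤ t) : IsBroadcastDominatingSet G t r Finset.univ := by
  classical
  intro u
  have hmem : u ∈ broadcastNeighborhood G t u := by
    simp only [broadcastNeighborhood, Set.mem_ofPred_eq, SimpleGraph.edist_self]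
    exact_mod_cast (by omega : 0 < t)
  unfold receptionStrength
  refine le_trans ?_ (Finset.single_le_sum (f := fun v => t - G.dist u v)
    (fun _ _ => Nat.zero_le _) (Finset.mem_filter.2 ⟨Finset.mem_univ u, hmem⟩))
  simpa using hrt

/-- The `m × n` grid graph `G_{m,n}` with `m` rows and `n` columns: the Cartesian product of the
paths on `m` and on `n` vertices. -/
def gridGraph (m n : ℕ) : SimpleGraph (Fin m × Fin n) :=
  SimpleGraph.boxProd (SimpleGraph.pathGraph m) (SimpleGraph.pathGraph n)

end BroadcastDomination

/-!
A vertex of the grid receives strength at least `2` exactly when it broadcasts or has two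
broadcasting neighbours (`isBroadcastDominatingSet_two_two_iff`). In the `5 × n` grid this is a
condition on each column and the two columns next to it (`isBroadcastDominatingSet_cellSet_iff`), so
the problem is one of shortest paths in a finite graph whose states are pairs of adjacent columns.

*Lower bound.* Such a problem has a dual certificate: a potential on the states. Each column is
charged `15 / 7`, the optimal density, and everything is scaled by `7`. Adding a column with `k`
cells raises the function `potential` by at most `7 * k - 15` (`potential_step_of_mask`), a first
column of `k` cells has potential at most `20 + 7 * k - 15` (`potential_start`), and a last column
has potential at least `22` (`potential_end_of_mask`). Adding up gives `15 * n + 2 ≤ 7 * |S|`, that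
is, `|S| ≥ 2 * n + (n + 2) / 7`. The potential depends only on the last column and on the cells in
it that still lack a neighbour, which leaves 90 states; its three properties are a finite check
over all masks.

*Upper bound.* Seven columns holding fifteen cells, which return to the state they start from,
are inserted repeatedly into optimal dominating sets of the `5 × n` grids with `5 ≤ n ≤ 11`
(`exists_completes`).
-/

namespace BroadcastDomination

/-! ### Reception strength for `t = r = 2` -/

open Classical in
/-- For `t = 2` a broadcasting vertex sends strength `2` to itself, strength `1` to its neighbours
and nothing further. -/
theorem receptionStrength_two {V : Type*} (G : SimpleGraph V) (S : Finset V) (u : V) :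
    receptionStrength G 2 S u =
      (if u ∈ S then 2 else 0) + (S.filter fun v => G.Adj u v).card := by
  have key : ∀ v, (if u ∈ broadcastNeighborhood G 2 v then 2 - G.dist u v else 0) =
      (if u = v then 2 else 0) + (if G.Adj u v then 1 else 0) := by
    intro v
    have hmem : u ∈ broadcastNeighborhood G 2 v ↔ G.edist u v < ((2 : ℕ) : ℕ∞) := Iff.rfl
    rcases eq_or_ne u v with rfl | hne
    · simp [hmem]
    · by_cases hadj : G.Adj u v
      · simp [hmem, hne, hadj, SimpleGraph.edist_eq_one_iff_adj.2 hadj,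
          SimpleGraph.dist_eq_one_iff_adj.2 hadj]
      · have h1 : G.edist u v ≠ 1 := fun h => hadj (SimpleGraph.edist_eq_one_iff_adj.1 h)
        have h0 : G.edist u v ≠ 0 := fun h => hne (SimpleGraph.edist_eq_zero_iff.1 h)
        have hfar : u ∉ broadcastNeighborhood G 2 v := by
          rw [hmem]
          intro h
          obtain ⟨k, hk⟩ := ENat.ne_top_iff_exists.1 (ne_top_of_lt h)
          rw [← hk] at h h0 h1
          norm_cast at h h0 h1
          omega
        rw [if_neg hfar, if_neg hne, if_neg hadj]
  rw [receptionStrength, Finset.sum_filter, Finset.sum_congr rfl fun v _ => key v,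
    Finset.sum_add_distrib, Finset.sum_ite_eq, Finset.card_filter]

open Classical in
/-- `(2, 2)` broadcast domination is `2`-domination. -/
theorem isBroadcastDominatingSet_two_two_iff {V : Type*} (G : SimpleGraph V) (S : Finset V) :
    IsBroadcastDominatingSet G 2 2 S ↔
      ∀ u, u ∈ S ∨ 2 ≤ (S.filter fun v => G.Adj u v).card := by
  refine forall_congr' fun u => ?_
  rw [receptionStrength_two]
  split_ifs with h <;> simp [h]

open Classical in
/-- A sum over the neighbours of a vertex of a path, for a function `f` of the positions shifted by
one: the conditions `h0` and `hn` say that `f` vanishes just beyond both ends. -/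
theorem sum_pathGraph_adj (n : ℕ) (f : ℕ → ℕ) (h0 : f 0 = 0) (hn : f (n + 1) = 0) (j : Fin n) :
    ∑ k : Fin n, (if (SimpleGraph.pathGraph n).Adj j k then f (k + 1) else 0) =
      f j + f (j + 2) := by
  have key : ∀ k : ℕ, (if (j : ℕ) + 1 = k ∨ k + 1 = j then f (k + 1) else 0) =
      (if (j : ℕ) + 1 = k then f (k + 1) else 0) + (if k + 1 = j then f (k + 1) else 0) := by
    intro k
    split_ifs <;> omega
  simp only [SimpleGraph.pathGraph_adj]
  rw [Fin.sum_univ_eq_sum_range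
    (fun k => if (j : ℕ) + 1 = k ∨ k + 1 = j then f (k + 1) else 0) n,
    Finset.sum_congr rfl fun k _ => key k, Finset.sum_add_distrib, Finset.sum_ite_eq, add_comm]
  congr 1
  · rcases j with ⟨_ | m, hj⟩
    · simp [h0]
    · simp only [add_left_inj]
      rw [Finset.sum_ite_eq', if_pos (Finset.mem_range.2 (by omega))]
  · split_ifs with h
    · rfl
    · rw [Finset.mem_range, not_lt] at h
      rw [← hn]
      congr 1
      omega

/-! ### Column masks -/

/-- The number of the four grid neighbours of the cell in row `i` of column `b` that belong to
the broadcasting set, where `a` and `c` are the columns to the left and to the right of `b`.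
A column is encoded as a bit mask, bit `i` telling whether row `i` is occupied; doubling `b` shifts
its rows by one, so that the neighbours above and below are bits `i` and `i + 2` of `2 * b`. -/
def neighborCount (a b c i : ℕ) : ℕ :=
  ((2 * b).testBit i).toNat + ((2 * b).testBit (i + 2)).toNat +
    ((a.testBit i).toNat + (c.testBit i).toNat)

/-- Every cell of column `b`, placed between `a` and `c`, is occupied or has two occupied
neighbours. -/
def ColumnDominated (a b c : ℕ) : Prop :=
  ∀ i < 5, b.testBit i = true ∨ 2 ≤ neighborCount a b c i

instance (a b c : ℕ) : Decidable (ColumnDominated a b c) :=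
  inferInstanceAs (Decidable (∀ i < 5, b.testBit i = true ∨ 2 ≤ neighborCount a b c i))

/-- The number of occupied cells of a column. -/
def columnSize (b : ℕ) : ℕ := ∑ i : Fin 5, (b.testBit i).toNat

/-- The set of cells of the `5 × n` grid given by the column masks `c 1, …, c n`. The index is
shifted by one, so that `c 0` and `c (n + 1)` can serve as empty columns bordering the grid. -/
def cellSet (n : ℕ) (c : ℕ → ℕ) : Finset (Fin 5 × Fin n) :=
  Finset.univ.filter fun p => (c (p.2 + 1)).testBit p.1 = true

theorem card_cellSet (n : ℕ) (c : ℕ → ℕ) :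
    (cellSet n c).card = ∑ j ∈ Finset.range n, columnSize (c (j + 1)) := by
  rw [cellSet, Finset.card_filter, Fintype.sum_prod_type_right,
    ← Fin.sum_univ_eq_sum_range (fun j => columnSize (c (j + 1)))]
  refine Finset.sum_congr rfl fun j _ => Finset.sum_congr rfl fun i _ => ?_
  cases (c (j + 1)).testBit i <;> rfl

open Classical in
theorem card_adj_cellSet {n : ℕ} {c : ℕ → ℕ} (hc : ∀ j, c j < 32) (h0 : c 0 = 0)
    (hn : c (n + 1) = 0) (i : Fin 5) (j : Fin n) :
    ((cellSet n c).filter fun v => (gridGraph 5 n).Adj (i, j) v).card =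
      neighborCount (c j) (c (j + 1)) (c (j + 2)) i := by
  -- A neighbour of `(i, j)` lies either in the same column or in the same row, and not in both.
  have key : ∀ v : Fin 5 × Fin n,
      (if (c (v.2 + 1)).testBit v.1 = true ∧ (gridGraph 5 n).Adj (i, j) v then 1 else 0) =
        (if j = v.2 then (if (SimpleGraph.pathGraph 5).Adj i v.1 then
          ((c (v.2 + 1)).testBit v.1).toNat else 0) else 0) +
        (if i = v.1 then (if (SimpleGraph.pathGraph n).Adj j v.2 then
          ((c (v.2 + 1)).testBit v.1).toNat else 0) else 0) := by
    rintro ⟨k, l⟩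
    rw [gridGraph, SimpleGraph.boxProd_adj]
    dsimp only
    rcases eq_or_ne i k with rfl | hik <;> rcases eq_or_ne j l with rfl | hjl <;>
      cases (c (_ + 1)).testBit _ <;> simp [*]
  rw [cellSet, Finset.filter_filter, Finset.card_filter, Finset.sum_congr rfl fun v _ => key v,
    Finset.sum_add_distrib, Fintype.sum_prod_type,
    Fintype.sum_prod_type_right (f := fun v => ite (i = v.1) _ _)]
  simp only [Finset.sum_ite_eq, Finset.mem_univ, if_true]
  rw [sum_pathGraph_adj n (fun k => ((c k).testBit i).toNat) (by simp [h0]) (by simp [hn]) j]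
  have hs : ∀ k, (c (j + 1)).testBit k = (2 * c (j + 1)).testBit (k + 1) := by
    intro k
    rw [Nat.testBit_succ, Nat.mul_div_cancel_left _ two_pos]
  simp only [hs]
  rw [sum_pathGraph_adj 5 (fun k => ((2 * c (j + 1)).testBit k).toNat) (by simp) _ i]
  · rfl
  · have : c (j + 1) < 2 ^ 5 := hc _
    rw [← hs, Nat.testBit_lt_two_pow this]
    rfl

theorem isBroadcastDominatingSet_cellSet_iff {n : ℕ} {c : ℕ → ℕ} (hc : ∀ j, c j < 32)
    (h0 : c 0 = 0) (hn : c (n + 1) = 0) :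
    IsBroadcastDominatingSet (gridGraph 5 n) 2 2 (cellSet n c) ↔
      ∀ j < n, ColumnDominated (c j) (c (j + 1)) (c (j + 2)) := by
  simp only [isBroadcastDominatingSet_two_two_iff, Prod.forall, card_adj_cellSet hc h0 hn]
  constructor
  · intro h j hj i hi
    simpa [cellSet] using h ⟨i, hi⟩ ⟨j, hj⟩
  · intro h i j
    simpa [cellSet] using h j j.2 i i.2

theorem exists_cellSet_eq {n : ℕ} (S : Finset (Fin 5 × Fin n)) :
    ∃ c : ℕ → ℕ, (∀ j, c j < 32) ∧ c 0 = 0 ∧ c (n + 1) = 0 ∧ cellSet n c = S := by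
  refine ⟨fun j => Nat.ofBits fun i : Fin 5 => decide (∃ l : Fin n, (l : ℕ) + 1 = j ∧ (i, l) ∈ S),
    fun j => Nat.ofBits_lt_two_pow _, ?_, ?_, ?_⟩
  · apply Nat.eq_of_testBit_eq
    intro i
    by_cases hi : i < 5
    · simp [Nat.testBit_ofBits_lt _ _ hi]
    · simp [Nat.testBit_ofBits_ge _ _ (not_lt.1 hi)]
  · apply Nat.eq_of_testBit_eq
    intro i
    by_cases hi : i < 5
    · simp only [Nat.testBit_ofBits_lt _ _ hi, Nat.zero_testBit, decide_eq_false_iff_not]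
      rintro ⟨l, hl, -⟩
      have := l.2
      omega
    · simp [Nat.testBit_ofBits_ge _ _ (not_lt.1 hi)]
  · ext ⟨i, j⟩
    simp only [cellSet, Finset.mem_filter, Finset.mem_univ, true_and,
      Nat.testBit_ofBits_lt _ _ i.2, decide_eq_true_eq]
    constructor
    · rintro ⟨l, hl, h⟩
      have : l = j := Fin.ext (by omega)
      exact this ▸ h
    · exact fun h => ⟨j, rfl, h⟩

/-! ### The lower bound: a potential on pairs of columns -/

/-- The mask of the cells of column `b` which, with `a` to the left, still need an occupied right
neighbour. -/
def deficit (a b : ℕ) : ℕ :=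
  Nat.ofBits fun i : Fin 5 => !b.testBit i && decide (neighborCount a b 0 i < 2)

/-- The potential of a partial filling, tabulated by its last column `b` (the index in the outer
list) and by the deficit of `b` (first components). The second component is `20` plus the least
value of `7 * (number of cells) - 15 * (number of columns)` over all fillings of an initial segment
of the strip that end in this state, with every earlier column dominated; the shift by `20` makes
all entries at least `15`. States in which some cell of `b` would need two more neighbours are
absent. -/
def potentialTable : List (List (ℕ × ℕ)) :=
  [[(0b11111, 20)], [(0b11100, 20), (0b11110, 20)], [(0b11000, 20), (0b11001, 24), (0b11100, 15),
     (0b11101, 17)], [(0b11000, 24), (0b11100, 22)], [(0b10001, 22), (0b10011, 17), (0b11001, 17),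
     (0b11011, 17)], [(0b10000, 24), (0b11000, 19)], [(0b10000, 22), (0b10001, 24), (0b11000, 20),
     (0b11001, 19)], [(0b10000, 28), (0b11000, 25)], [(0b00011, 20), (0b00111, 15), (0b10011, 24),
     (0b10111, 17)], [(0b00000, 24), (0b00010, 23), (0b00100, 20), (0b00110, 24), (0b10000, 25),
     (0b10010, 21), (0b10100, 21), (0b10110, 19)], [(0b00000, 22), (0b00001, 22), (0b10000, 22),
     (0b10001, 19)], [(0b00000, 25), (0b10000, 26)], [(0b00001, 22), (0b00011, 20), (0b10001, 24),
     (0b10011, 19)], [(0b00000, 25), (0b10000, 26)], [(0b00000, 27), (0b00001, 26), (0b10000, 26),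
     (0b10001, 26)], [(0b00000, 32), (0b10000, 28)], [(0b00111, 20), (0b01111, 20)],
   [(0b00100, 25), (0b00110, 21), (0b01100, 21), (0b01110, 21)], [(0b00000, 24), (0b00001, 25),
     (0b00100, 20), (0b00101, 21), (0b01000, 23), (0b01001, 21), (0b01100, 24), (0b01101, 19)],
   [(0b00000, 25), (0b00100, 25), (0b01000, 23), (0b01100, 26)], [(0b00001, 24), (0b00011, 19)],
   [(0b00000, 25)], [(0b00000, 25), (0b00001, 26)], [(0b00000, 28)], [(0b00011, 24),
     (0b00111, 22)], [(0b00000, 25), (0b00010, 23), (0b00100, 25), (0b00110, 26)], [(0b00000, 25),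
     (0b00001, 26)], [(0b00000, 30)], [(0b00001, 28), (0b00011, 25)], [(0b00000, 28)],
   [(0b00000, 32), (0b00001, 28)], [(0b00000, 35)]]

/-- The potential of two adjacent columns `a` and `b`. Being dominated when the next column is full
means that no cell of `b` needs more than one further neighbour; if this fails, then no next column
can make `b` dominated, and the potential is set to `0`. -/
def potential (a b : ℕ) : ℕ :=
  if ColumnDominated a b 0b11111 then
    ((potentialTable.getD b []).lookup (deficit a b)).getD 0
  else 0

/-- The mask of the cells of `b`, placed between `a` and `c`, that are occupied or have two occupied
neighbours, computed by bitwise operations, on which kernel evaluation is fast. Bits from `5` on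
have no meaning. -/
def dominatedMask (a b c : ℕ) : ℕ :=
  b ||| (a &&& c) ||| (2 * b &&& b >>> 1) ||| ((a ||| c) &&& (2 * b ||| b >>> 1))

theorem ColumnDominated.dominatedMask_and {a b c : ℕ} (h : ColumnDominated a b c) :
    dominatedMask a b c &&& 31 = 31 := by
  apply Nat.eq_of_testBit_eq
  intro i
  have h31 : Nat.testBit 31 i = decide (i < 5) := Nat.testBit_two_pow_sub_one 5 i
  rw [Nat.testBit_and, h31]
  by_cases hi : i < 5
  · have h2 : (2 * b).testBit (i + 2) = b.testBit (i + 1) := by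
      rw [Nat.testBit_succ, Nat.mul_div_cancel_left _ two_pos]
    have h1 := h i hi
    simp only [neighborCount, h2] at h1
    simp only [dominatedMask, Nat.testBit_or, Nat.testBit_and, Nat.testBit_shiftRight, hi,
      Nat.add_comm 1 i]
    revert h1
    generalize b.testBit i = x1
    generalize a.testBit i = x2
    generalize c.testBit i = x3
    generalize b.testBit (i + 1) = x4
    generalize (2 * b).testBit i = x5
    revert x1 x2 x3 x4 x5
    decide
  · simp [hi]

/-- Adding a column `c` of `k` cells raises the potential by at most `7 * k - 15`. -/
theorem potential_step_of_mask : ∀ a < 32, ∀ b < 32, ∀ c < 32, dominatedMask a b c &&& 31 = 31 →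
    potential b c + 15 ≤ potential a b + 7 * columnSize c := by decide +kernel

theorem potential_start : ∀ b < 32, potential 0 b + 15 ≤ 7 * columnSize b + 20 := by decide +kernel

theorem potential_end_of_mask : ∀ a < 32, ∀ b < 32, dominatedMask a b 0 &&& 31 = 31 →
    22 ≤ potential a b := by
  decide +kernel

theorem le_card_of_isBroadcastDominatingSet {n : ℕ} (hn : 0 < n) {S : Finset (Fin 5 × Fin n)}
    (hS : IsBroadcastDominatingSet (gridGraph 5 n) 2 2 S) : 15 * n + 2 ≤ 7 * S.card := by
  obtain ⟨c, hc, h0, hlast, rfl⟩ := exists_cellSet_eq S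
  rw [isBroadcastDominatingSet_cellSet_iff hc h0 hlast] at hS
  rw [card_cellSet]
  -- The potential inequalities, summed over the first `k + 1` columns.
  have main : ∀ k < n, potential (c k) (c (k + 1)) + 15 * (k + 1) ≤
      7 * ∑ j ∈ Finset.range (k + 1), columnSize (c (j + 1)) + 20 := by
    intro k
    induction k with
    | zero =>
      intro _
      simpa [h0] using potential_start (c 1) (hc 1)
    | succ k ih =>
      intro hk
      have h1 := ih (by omega)
      have h2 := potential_step_of_mask _ (hc _) _ (hc _) _ (hc _)
        (hS k (by omega)).dominatedMask_and
      rw [Finset.sum_range_succ, show c (k + 1 + 1) = c (k + 2) from rfl]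
      omega
  obtain ⟨m, rfl⟩ := Nat.exists_eq_succ_of_ne_zero hn.ne'
  have h1 := main m (by omega)
  have h2 := hS m (by omega)
  rw [show c (m + 2) = 0 from hlast] at h2
  have h3 := potential_end_of_mask _ (hc _) _ (hc _) h2.dominatedMask_and
  simp only [Nat.succ_eq_add_one] at *
  omega

/-! ### The upper bound: periodic dominating sets -/

/-- The columns `w`, followed by the border of the grid, may be placed after the adjacent columns
`a` and `b`: every column from `b` on is dominated. -/
def Completes : ℕ → ℕ → List ℕ → Prop
  | a, b, [] => ColumnDominated a b 0
  | a, b, c :: w => ColumnDominated a b c ∧ Completes b c w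

instance Completes.decidable : ∀ (a b : ℕ) (w : List ℕ), Decidable (Completes a b w)
  | a, b, [] => inferInstanceAs (Decidable (ColumnDominated a b 0))
  | a, b, c :: w =>
    have := Completes.decidable b c w
    inferInstanceAs (Decidable (ColumnDominated a b c ∧ Completes b c w))

theorem Completes.columnDominated {a b : ℕ} {w : List ℕ} (h : Completes a b w) :
    ∀ j < w.length + 1, ColumnDominated ((a :: b :: w).getD j 0) ((a :: b :: w).getD (j + 1) 0)
      ((a :: b :: w).getD (j + 2) 0) := by
  induction w generalizing a b with
  | nil =>
    intro j hj
    obtain rfl : j = 0 := by simpa using hj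
    exact h
  | cons c w ih =>
    intro j hj
    cases j with
    | zero => exact h.1
    | succ j => exact ih h.2 j (by simpa using hj)

theorem sum_columnSize_getD (w : List ℕ) :
    ∑ j ∈ Finset.range w.length, columnSize (w.getD j 0) = (w.map columnSize).sum := by
  induction w with
  | nil => rfl
  | cons b w ih => simp [Finset.sum_range_succ', ← ih, add_comm]

/-- A list of columns in which every column is dominated is a dominating set of the grid. -/
theorem Completes.exists_isBroadcastDominatingSet {b : ℕ} {w : List ℕ} (h : Completes 0 b w)
    (hw : ∀ c ∈ b :: w, c < 32) :
    ∃ S : Finset (Fin 5 × Fin (b :: w).length),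
      IsBroadcastDominatingSet (gridGraph 5 (b :: w).length) 2 2 S ∧
        S.card = ((b :: w).map columnSize).sum := by
  refine ⟨cellSet _ fun j => (0 :: b :: w).getD j 0,
    (isBroadcastDominatingSet_cellSet_iff ?_ rfl ?_).2 h.columnDominated, ?_⟩
  · intro j
    rcases lt_or_ge j (0 :: b :: w).length with hj | hj
    · rw [List.getD_eq_getElem _ _ hj]
      have := List.getElem_mem hj
      rcases List.mem_cons.1 this with h | h
      · rw [h]; norm_num
      · exact hw _ h
    · rw [List.getD_eq_default _ _ hj]
      norm_num
  · exact List.getD_eq_default _ _ le_rfl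
  · rw [card_cellSet, ← sum_columnSize_getD]
    rfl

/-- An optimal filling of the grid after a fixed beginning: seven explicit endings, one for each
length modulo `7`, are extended by a block of seven columns and fifteen cells. The block ends with
the two columns after which it starts, so it can be inserted any number of times. -/
theorem exists_completes (n : ℕ) : ∃ w : List ℕ, w.length = n + 2 ∧ (∀ c ∈ w, c < 32) ∧
    Completes 0b10011 0b00100 w ∧ (w.map columnSize).sum = 2 * n + 5 + (n + 6) / 7 := by
  induction n using Nat.strong_induction_on with
  | _ n ih =>
    rcases lt_or_ge n 7 with hn | hn
    · interval_cases n
      · exact ⟨[0b11001, 0b01010], by decide +kernel⟩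
      · exact ⟨[0b11001, 0b00010, 0b11101], by decide +kernel⟩
      · exact ⟨[0b11001, 0b00010, 0b11101, 0b01010], by decide +kernel⟩
      · exact ⟨[0b11001, 0b00110, 0b10001, 0b01100, 0b10011], by decide +kernel⟩
      · exact ⟨[0b11001, 0b00010, 0b11101, 0b00100, 0b10011, 0b01010], by decide +kernel⟩
      · exact ⟨[0b11001, 0b00110, 0b10010, 0b01001, 0b01100, 0b10011, 0b01010],
          by decide +kernel⟩
      · exact ⟨[0b11001, 0b00010, 0b11101, 0b00010, 0b11001, 0b00100, 0b10011, 0b01010],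
          by decide +kernel⟩
    · obtain ⟨w, hl, hlt, hw, hs⟩ := ih (n - 7) (by omega)
      refine ⟨0b11001 :: 0b00110 :: 0b10010 :: 0b01001 :: 0b01100 :: 0b10011 :: 0b00100 :: w,
        ?_, ?_, ?_, ?_⟩
      · simp only [List.length_cons, hl]
        omega
      · simp only [List.forall_mem_cons]
        exact ⟨by norm_num, by norm_num, by norm_num, by norm_num, by norm_num, by norm_num,
          by norm_num, hlt⟩
      · exact ⟨by decide, by decide, by decide, by decide, by decide, by decide, by decide, hw⟩
      · have h15 : columnSize 0b11001 + (columnSize 0b00110 + (columnSize 0b10010 +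
            (columnSize 0b01001 + (columnSize 0b01100 + (columnSize 0b10011 +
              columnSize 0b00100))))) = 15 := by decide
        simp only [List.map_cons, List.sum_cons, hs]
        omega

theorem exists_isBroadcastDominatingSet_card {n : ℕ} (hn : 5 ≤ n) :
    ∃ S : Finset (Fin 5 × Fin n), IsBroadcastDominatingSet (gridGraph 5 n) 2 2 S ∧
      S.card = 2 * n + (n + 8) / 7 := by
  obtain ⟨w, hl, hlt, hw, hs⟩ := exists_completes (n - 5)
  have hc : Completes 0 0b01010 (0b10011 :: 0b00100 :: w) := ⟨by decide, by decide, hw⟩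
  obtain ⟨S, hS, hcard⟩ := hc.exists_isBroadcastDominatingSet (by
    simp only [List.forall_mem_cons]
    exact ⟨by norm_num, by norm_num, by norm_num, hlt⟩)
  have hlen : (0b01010 :: 0b10011 :: 0b00100 :: w).length = n := by
    simp only [List.length_cons, hl]
    omega
  have h6 : columnSize 0b01010 + (columnSize 0b10011 + columnSize 0b00100) = 6 := by decide
  have hsum : S.card = 2 * n + (n + 8) / 7 := by
    rw [hcard]
    simp only [List.map_cons, List.sum_cons, hs]
    omega
  generalize (0b01010 :: 0b10011 :: 0b00100 :: w).length = m at *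
  subst hlen
  exact ⟨S, hS, hsum⟩

/-! ### The domination number -/

theorem natCeil_add_two_div_seven (n : ℕ) : ⌈((n : ℚ) + 2) / 7⌉₊ = (n + 8) / 7 := by
  rw [Nat.ceil_eq_iff (by omega)]
  have h1 : (n + 8) / 7 * 7 ≤ n + 8 := by omega
  have h2 : n + 2 ≤ (n + 8) / 7 * 7 := by omega
  have h3 : ((n + 8) / 7 - 1) * 7 + 1 ≤ n + 2 := by omega
  constructor
  · rw [lt_div_iff₀ (by norm_num)]
    exact_mod_cast (by omega : ((n + 8) / 7 - 1) * 7 < n + 2)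
  · rw [div_le_iff₀ (by norm_num)]
    exact_mod_cast h2

end BroadcastDomination

theorem mainTheorem3 (n : ℕ) (hn : 5 ≤ n) :
    BroadcastDomination.broadcastDominationNumber (BroadcastDomination.gridGraph 5 n) 2 2 =
      2 * n + ⌈((n : ℚ) + 2) / 7⌉₊ := by
  rw [BroadcastDomination.natCeil_add_two_div_seven]
  have hex := BroadcastDomination.exists_isBroadcastDominatingSet_card hn
  refine le_antisymm (Nat.sInf_le hex) (le_csInf ⟨_, hex⟩ ?_)
  rintro k ⟨S, hS, rfl⟩
  have := BroadcastDomination.le_card_of_isBroadcastDominatingSet (by omega) hS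
  omega
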